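/- Let $d\ge 1$, let $Q=(q_{ij})_{i,j=1}^d$ be the transition rate matrix of an irreducible continuous-time Markov process on $\{1,\dots,d\}$, with stationary distribution $\pi=(\pi_1,\dots,\pi_d)$, and let $\lambda_k\ge 0$, $\mu_k>0$ ($k=1,\dots,d$) and $\alpha>0$. For $N\in\mathbb N$, $N\ge1$, consider the infinite-server queue (Model II) whose background process $J^{(N)}$ has rate matrix $N^\alpha Q$, in which jobs arrive at Poisson rate $N\lambda_k$ while $J^{(N)}$ is in state $k$, and in which a job that arrives while $J^{(N)}$ is in state $k$ (a job of type $k$) has an exponentially distributed service time with rate $\mu_k$. That is, with $M^{(N)}_k(t)$ the number of jobs of type $k$ present at time $t$ and $\boldsymbol M^{(N)}(t)=(M^{(N)}_1(t),\dots,M^{(N)}_d(t))$, the pair $(\boldsymbol M^{(N)}(t),J^{(N)}(t))_{t\ge 0}$ is a Markov process on $\mathbb Z_{\ge0}^d\times\{1,\dots,d\}$ which jumps from $(\boldsymbol m,i)$ to $(\boldsymbol m,j)$, $j\neq i$, at rate $N^\alpha q_{ij}$, to $(\boldsymbol m+\boldsymbol e_i,i)$ at rate $N\lambda_i$, and to $(\boldsymbol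 m-\boldsymbol e_k,i)$ at rate $\mu_k m_k$ for each $k$ with $m_k\ge 1$. The system starts empty, $\boldsymbol M^{(N)}(0)=\boldsymbol 0$, and the law of $J^{(N)}(0)$ is arbitrary. Let $\boldsymbol M^{(N)}=(M_1^{(N)},\dots,M_d^{(N)})$ be the stationary counterpart of $\boldsymbol M^{(N)}(t)$, i.e. the first component of a random element distributed according to the stationary distribution of this Markov process. Put $M^{(N)}(t)=\sum_k M^{(N)}_k(t)$, $M^{(N)}=\sum_k M^{(N)}_k$, $$\varrho_k(t)=\pi_k\frac{\lambda_k}{\mu_k}\bigl(1-e^{-\mu_k t}\bigr),\qquad \varrho_k=\pi_k\frac{\lambda_k}{\mu_k}\qquad(k=1,\dots,d).$$ Then, as $N\to\infty$: (1) for every $t\ge 0$, $N^{-1}\boldsymbol M^{(N)}(t)$ converges in probability to $(\varrho_1(t),\dots,\varrho_d(t))$; (2) $N^{-1}\boldsymbol M^{(N)}$ converges in probability to $(\varrho_1,\dots,\varrho_d)$; (3) for every $t\ge0$, $N^{-1}M^{(N)}(t)$ converges in probability to $\sum_{k=1}^d\varrho_k(t)$, and $N^{-1}M^{(N)}$ converges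 in probability to $\sum_{k=1}^d\varrho_k$. -/

import Mathlib

open MeasureTheory Filter Topology

namespace MMInfServer

/-- `Q` is the transition rate matrix of an irreducible continuous-time Markov process
on the finite state space `Fin d`: off-diagonal rates are nonnegative, rows sum to zero, and every
state can be reached from every other one through transitions of positive rate. -/
structure IsIrreducibleRateMatrix {d : ℕ} (Q : Matrix (Fin d) (Fin d) ℝ) : Prop where
  offDiag_nonneg : ∀ i j, i ≠ j → 0 ≤ Q i j
  row_sum : ∀ i, ∑ j, Q i j = 0
  irreducible : ∀ i j, Relation.ReflTransGen (fun a b => a ≠ b ∧ 0 < Q a b) i j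

/-- `π` is a stationary probability vector of the rate matrix `Q`. -/
structure IsStationaryVector {d : ℕ} (Q : Matrix (Fin d) (Fin d) ℝ) (π : Fin d → ℝ) : Prop where
  nonneg : ∀ i, 0 ≤ π i
  sum_one : ∑ i, π i = 1
  invariant : Matrix.vecMul π Q = 0

/-- `P` is an (honest, standard) Markov transition function on the countable state
space `S`, in continuous time `t ≥ 0`, with transition rates `G`, that is,
`P h x y = 1_{x = y} + G x y * h + o(h)` as `h ↓ 0`. -/
structure IsTransitionFunction {S : Type*} (G : S → S → ℝ) (P : ℝ → S → S → ℝ) : Prop where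
  nonneg : ∀ t, 0 ≤ t → ∀ x y, 0 ≤ P t x y
  sum_one : ∀ t, 0 ≤ t → ∀ x, HasSum (fun y => P t x y) 1
  zero_apply : ∀ x, P 0 x x = 1
  chapman_kolmogorov : ∀ s t, 0 ≤ s → 0 ≤ t → ∀ x z,
    HasSum (fun y => P s x y * P t y z) (P (s + t) x z)
  rates : ∀ x y, HasDerivWithinAt (fun h => P h x y) (G x y) (Set.Ici 0) 0

/-- `X = (X t)_{t ≥ 0}` is a time-homogeneous Markov process on the countable
(discrete) space `S` with transition rates `G`. The initial law is arbitrary. -/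
structure IsMarkovProcess {Ω S : Type*} [MeasurableSpace Ω] [MeasurableSpace S]
    (ℙ : Measure Ω) (G : S → S → ℝ) (X : ℝ → Ω → S) : Prop where
  measurable : ∀ t, 0 ≤ t → Measurable (X t)
  markov : ∃ P : ℝ → S → S → ℝ, IsTransitionFunction G P ∧
    ∀ (n : ℕ) (t : Fin (n + 1) → ℝ) (x : Fin (n + 1) → S), 0 ≤ t 0 → Monotone t →
      ℙ.real {ω | ∀ i, X (t i) ω = x i} =
        ℙ.real {ω | X (t 0) ω = x 0} *
          ∏ i : Fin n, P (t i.succ - t i.castSucc) (x i.castSucc) (x i.succ)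

/-- The `S`-valued random element `Z` is distributed according to a stationary distribution of the
Markov process with transition rates `G`. -/
structure HasStationaryLaw {Ω S : Type*} [MeasurableSpace Ω] [MeasurableSpace S]
    (ℙ : Measure Ω) (G : S → S → ℝ) (Z : Ω → S) : Prop where
  measurable : Measurable Z
  stationary : ∃ P : ℝ → S → S → ℝ, IsTransitionFunction G P ∧
    ∀ t, 0 ≤ t → ∀ y,
      HasSum (fun x => ℙ.real {ω | Z ω = x} * P t x y) (ℙ.real {ω | Z ω = y})

/-- The transition rate, from `x = (m, i)` to `y`, of the pair (numbers of jobs present of each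
type, background state) in Model II. The type of a job is the background state upon its arrival.
* `(m, i) → (m, j)`, `j ≠ i`, at rate `Q i j` (background transition);
* `(m, i) → (m + e_i, i)` at rate `lam i` (arrival; the new job gets type `i`);
* `(m, i) → (m - e_k, i)` at rate `mu k * m k` (each type-`k` job present leaves at rate `mu k`);
* the diagonal entry makes the row sums vanish (`Q i i` is minus the total background rate). -/
def modelIIRate {d : ℕ} (Q : Matrix (Fin d) (Fin d) ℝ) (lam mu : Fin d → ℝ)
    (x y : (Fin d → ℕ) × Fin d) : ℝ :=
  (if y.1 = x.1 then Q x.2 y.2 else 0)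
    + (if y = (x.1 + Pi.single x.2 1, x.2) then lam x.2 else 0)
    + (∑ k, if y.1 + Pi.single k 1 = x.1 ∧ y.2 = x.2 then mu k * (x.1 k : ℝ) else 0)
    - (if y = x then lam x.2 + ∑ k, mu k * (x.1 k : ℝ) else 0)

/-- Model II under the scaling `lam ↦ N lam`, `Q ↦ N ^ α Q`. -/
noncomputable def scaledRate {d : ℕ} (Q : Matrix (Fin d) (Fin d) ℝ) (lam mu : Fin d → ℝ)
    (α : ℝ) (N : ℕ) : (Fin d → ℕ) × Fin d → (Fin d → ℕ) × Fin d → ℝ :=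
  modelIIRate (((N : ℝ) ^ α) • Q) ((N : ℝ) • lam) mu

/-- The `k`-th component of the transient limit. -/
noncomputable def rhoT {d : ℕ} (π lam mu : Fin d → ℝ) (t : ℝ) (k : Fin d) : ℝ :=
  π k * (lam k / mu k) * (1 - Real.exp (-(mu k * t)))

/-- The `k`-th component of the stationary limit. -/
noncomputable def rho {d : ℕ} (π lam mu : Fin d → ℝ) (k : Fin d) : ℝ :=
  π k * (lam k / mu k)

/-- Convergence in probability, as `N → ∞`, of random elements `X N`, each defined on its own
probability space, to a deterministic limit `c`. -/
def TendstoInProb {E : Type*} [PseudoMetricSpace E] {Ω : ℕ → Type*}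
    [∀ N, MeasurableSpace (Ω N)] (ℙ : ∀ N, Measure (Ω N)) (X : ∀ N, Ω N → E) (c : E) : Prop :=
  ∀ ε : ℝ, 0 < ε → Tendsto (fun N => ℙ N {ω | ε ≤ dist (X N ω) c}) atTop (𝓝 0)

end MMInfServer

/-! Everything reduces to one coordinate `k` and one second-moment bound. Started from `x` scaled
type-`k` jobs, the scaled count after time `t` should be near `x e + r (1 - e)`, where `e = exp (-μ
t)` and `r` is the `k`-th coordinate of `rho`. The squared distance of this prediction to a constant
`c` nearly solves the backward equation, except that arrivals occur at rate `λ 1{J = k}` and not at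
the averaged rate `λ π_k`. Solving the Poisson equation `Q h = 1_k - π_k` and subtracting the
corrector `N ^ (-α) λ e h(J)` removes the discrepancy, because the background generator carries the
factor `N ^ α`. The remaining errors are at most of order `N ^ (-α)` and `1 / N`; a slight inflation
absorbs them and yields a genuine supersolution, `superSol` (`superSol_drift`).

A nonnegative supersolution dominates the semigroup (`semigroupApply_le_of_supersolution`): this is
a maximum principle, in which the total number of jobs serves as Lyapunov function and leaves only
finitely many states to consider. The result is `semigroupApply_indicator_le`, a Chebyshev-type
bound from every initial state.

From the empty state with `c = rhoT` this bound vanishes as `N → ∞`. For the stationary law,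
invariance permits `t → ∞` at fixed `N`; the bound then forgets the initial state, so no moments of
the stationary law are needed. The coordinates are combined by a union bound. -/

namespace MMInfServer

/-! ### Stochastic kernels and generators on a countable space. -/

/-- A law `b = a K`, with `K` a stochastic kernel on a countable space, integrates a function `f`
with values in `[0, 1]` as `a` integrates `K f`. -/
theorem hasSum_mul_kernel {S : Type*} {a b f : S → ℝ} {K : S → S → ℝ}
    (ha : ∀ x, 0 ≤ a x) (ha' : Summable a) (hK : ∀ x y, 0 ≤ K x y)
    (hK' : ∀ x, HasSum (K x) 1) (hb : ∀ y, HasSum (fun x => a x * K x y) (b y))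
    (hf : ∀ y, 0 ≤ f y) (hf' : ∀ y, f y ≤ 1) :
    HasSum (fun x => a x * ∑' y, K x y * f y) (∑' y, b y * f y) := by
  have hKf : ∀ x, Summable fun y => K x y * f y := fun x =>
    (hK' x).summable.of_nonneg_of_le (fun y => mul_nonneg (hK x y) (hf y))
      (fun y => mul_le_of_le_one_right (hK x y) (hf' y))
  have hKf1 : ∀ x, ∑' y, K x y * f y ≤ 1 := fun x => by
    rw [← (hK' x).tsum_eq]
    exact (hKf x).tsum_le_tsum (fun y => mul_le_of_le_one_right (hK x y) (hf' y)) (hK' x).summable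
  have hKf0 : ∀ x, 0 ≤ ∑' y, K x y * f y := fun x =>
    tsum_nonneg fun y => mul_nonneg (hK x y) (hf y)
  have houter : Summable fun x => a x * ∑' y, K x y * f y :=
    ha'.of_nonneg_of_le (fun x => mul_nonneg (ha x) (hKf0 x))
      (fun x => mul_le_of_le_one_right (ha x) (hKf1 x))
  have hprod : Summable (Function.uncurry fun x y => a x * (K x y * f y)) := by
    refine (summable_prod_of_nonneg
      (fun p => mul_nonneg (ha p.1) (mul_nonneg (hK p.1 p.2) (hf p.2)))).2
      ⟨fun x => (hKf x).mul_left (a x), ?_⟩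
    simpa only [Function.uncurry_apply_pair, tsum_mul_left] using houter
  have hswap := hprod.tsum_comm
  simp only [tsum_mul_left] at hswap
  have hrow : ∀ y, ∑' x, a x * (K x y * f y) = b y * f y := fun y => by
    rw [← (hb y).tsum_eq, ← tsum_mul_right]
    simp only [mul_assoc]
  simp only [hrow] at hswap
  rw [hswap]
  exact houter.hasSum

/-- The rates `G` are conservative, with finitely many transitions out of each state. -/
structure IsRowFiniteGenerator {S : Type*} (G : S → S → ℝ) : Prop where
  finite_support : ∀ x, (Function.support (G x)).Finite
  offDiag_nonneg : ∀ x y, x ≠ y → 0 ≤ G x y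
  row_sum : ∀ x, HasSum (G x) 0

/-- The generator with rates `G` applied to a function. -/
noncomputable def genApply {S : Type*} (G : S → S → ℝ) (F : S → ℝ) (x : S) : ℝ :=
  ∑' y, G x y * F y

/-- The semigroup with transition function `P` applied to a function. -/
noncomputable def semigroupApply {S : Type*} (P : ℝ → S → S → ℝ) (f : S → ℝ) (t : ℝ) (x : S) : ℝ :=
  ∑' y, P t x y * f y

namespace IsRowFiniteGenerator

variable {S : Type*} {G : S → S → ℝ}

theorem hasSum_genApply (hG : IsRowFiniteGenerator G) (F : S → ℝ) (x : S) :
    HasSum (fun y => G x y * F y) (genApply G F x) :=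
  (summable_of_hasFiniteSupport ((hG.finite_support x).subset fun y hy => by
    intro h; simp [h] at hy)).hasSum

/-- One finite set serves all functions at once, so linear identities for the generator become
identities of finite sums. -/
theorem exists_finset (hG : IsRowFiniteGenerator G) (x : S) :
    ∃ s : Finset S, x ∈ s ∧ ∑ y ∈ s, G x y = 0 ∧
      ∀ F : S → ℝ, genApply G F x = ∑ y ∈ s, G x y * F y := by
  classical
  refine ⟨insert x (hG.finite_support x).toFinset, Finset.mem_insert_self _ _, ?_, fun F => ?_⟩
  · rw [← (hG.row_sum x).tsum_eq]
    refine (tsum_eq_sum fun y hy => ?_).symm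
    by_contra h
    exact hy (by simp [h])
  · refine tsum_eq_sum fun y hy => ?_
    have : G x y = 0 := by
      by_contra h
      exact hy (by simp [h])
    simp [this]

/-- Maximum principle: since rows sum to zero, `F y` may be replaced by `F y - F x`, which is
nonpositive and meets only off-diagonal rates. -/
theorem genApply_nonpos_of_isMax (hG : IsRowFiniteGenerator G) {F : S → ℝ} {x : S}
    (h : ∀ y, F y ≤ F x) : genApply G F x ≤ 0 := by
  have h1 := (hG.hasSum_genApply F x).sub ((hG.row_sum x).mul_right (F x))
  rw [zero_mul, sub_zero] at h1
  refine h1.nonpos fun y => ?_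
  rw [← mul_sub]
  rcases eq_or_ne x y with rfl | hxy
  · simp
  · exact mul_nonpos_of_nonneg_of_nonpos (hG.offDiag_nonneg x y hxy) (sub_nonpos.2 (h y))

end IsRowFiniteGenerator

/-! ### Backward equation and comparison principle. -/

namespace IsTransitionFunction

variable {S : Type*} {G : S → S → ℝ} {P : ℝ → S → S → ℝ} {f : S → ℝ}

theorem summable_mul (hP : IsTransitionFunction G P) (hf : ∀ y, 0 ≤ f y) (hf' : ∀ y, f y ≤ 1)
    {t : ℝ} (ht : 0 ≤ t) (x : S) : Summable fun y => P t x y * f y :=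
  (hP.sum_one t ht x).summable.of_nonneg_of_le (fun y => mul_nonneg (hP.nonneg t ht x y) (hf y))
    (fun y => mul_le_of_le_one_right (hP.nonneg t ht x y) (hf' y))

theorem semigroupApply_nonneg (hP : IsTransitionFunction G P) (hf : ∀ y, 0 ≤ f y)
    {t : ℝ} (ht : 0 ≤ t) (x : S) : 0 ≤ semigroupApply P f t x :=
  tsum_nonneg fun y => mul_nonneg (hP.nonneg t ht x y) (hf y)

theorem semigroupApply_le_one (hP : IsTransitionFunction G P) (hf : ∀ y, 0 ≤ f y)
    (hf' : ∀ y, f y ≤ 1) {t : ℝ} (ht : 0 ≤ t) (x : S) : semigroupApply P f t x ≤ 1 := by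
  rw [← (hP.sum_one t ht x).tsum_eq]
  exact (hP.summable_mul hf hf' ht x).tsum_le_tsum
    (fun y => mul_le_of_le_one_right (hP.nonneg t ht x y) (hf' y)) (hP.sum_one t ht x).summable

theorem sum_le_one (hP : IsTransitionFunction G P) {t : ℝ} (ht : 0 ≤ t) (x : S) (s : Finset S) :
    ∑ y ∈ s, P t x y ≤ 1 :=
  sum_le_hasSum s (fun y _ => hP.nonneg t ht x y) (hP.sum_one t ht x)

theorem zero_apply_of_ne (hP : IsTransitionFunction G P) {x y : S} (h : x ≠ y) : P 0 x y = 0 := by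
  classical
  have h1 := hP.sum_le_one le_rfl x {x, y}
  rw [Finset.sum_pair h, hP.zero_apply] at h1
  linarith [hP.nonneg 0 le_rfl x y]

theorem semigroupApply_zero (hP : IsTransitionFunction G P) (x : S) :
    semigroupApply P f 0 x = f x := by
  rw [semigroupApply, tsum_eq_single x, hP.zero_apply, one_mul]
  intro y hy
  rw [hP.zero_apply_of_ne hy.symm, zero_mul]

theorem hasSum_semigroupApply_add (hP : IsTransitionFunction G P) (hf : ∀ y, 0 ≤ f y)
    (hf' : ∀ y, f y ≤ 1) {h s : ℝ} (hh : 0 ≤ h) (hs : 0 ≤ s) (x : S) :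
    HasSum (fun y => P h x y * semigroupApply P f s y) (semigroupApply P f (h + s) x) :=
  hasSum_mul_kernel (hP.nonneg h hh x) (hP.sum_one h hh x).summable (hP.nonneg s hs)
    (hP.sum_one s hs) (fun y => hP.chapman_kolmogorov h s hh hs x y) hf hf'

/-- Up to the probability of leaving the finite set `s`, the semigroup property is a finite sum. -/
theorem abs_semigroupApply_add_sub_le (hP : IsTransitionFunction G P) (hf : ∀ y, 0 ≤ f y)
    (hf' : ∀ y, f y ≤ 1) {h t : ℝ} (hh : 0 ≤ h) (ht : 0 ≤ t) (x : S) (s : Finset S) :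
    |semigroupApply P f (h + t) x - ∑ y ∈ s, P h x y * semigroupApply P f t y|
      ≤ 1 - ∑ y ∈ s, P h x y := by
  have hu := hP.hasSum_semigroupApply_add hf hf' hh ht x
  have h0 := sum_le_hasSum s
    (fun y _ => mul_nonneg (hP.nonneg h hh x y) (hP.semigroupApply_nonneg hf ht y)) hu
  -- The same lower bound applied to `1 - f`: the terms `P h x y * (1 - u y)` are nonnegative as
  -- well.
  have h1 := sum_le_hasSum s
    (fun y _ => by
      have := mul_le_of_le_one_right (hP.nonneg h hh x y) (hP.semigroupApply_le_one hf hf' ht y)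
      linarith) ((hP.sum_one h hh x).sub hu)
  rw [Finset.sum_sub_distrib] at h1
  rw [abs_of_nonneg (by linarith)]
  linarith

/-- Only the probability of having left `x` by time `h` matters. The modulus does not involve `t`,
which gives continuity from both sides. -/
theorem abs_semigroupApply_add_sub_self_le (hP : IsTransitionFunction G P) (hf : ∀ y, 0 ≤ f y)
    (hf' : ∀ y, f y ≤ 1) {h t : ℝ} (hh : 0 ≤ h) (ht : 0 ≤ t) (x : S) :
    |semigroupApply P f (h + t) x - semigroupApply P f t x| ≤ 2 * (1 - P h x x) := by
  have h1 := hP.abs_semigroupApply_add_sub_le hf hf' hh ht x {x}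
  simp only [Finset.sum_singleton] at h1
  have h2 := hP.sum_le_one hh x {x}
  simp only [Finset.sum_singleton] at h2
  have h3 := hP.semigroupApply_nonneg hf ht x
  have h4 := hP.semigroupApply_le_one hf hf' ht x
  have h5 := hP.nonneg h hh x x
  rw [abs_le] at h1 ⊢
  constructor <;> nlinarith

theorem tendsto_diag (hP : IsTransitionFunction G P) (x : S) :
    Tendsto (fun h => P h x x) (𝓝[≥] 0) (𝓝 1) := by
  have := (hP.rates x x).continuousWithinAt
  rwa [ContinuousWithinAt, hP.zero_apply] at this

theorem continuousOn_semigroupApply (hP : IsTransitionFunction G P) (hf : ∀ y, 0 ≤ f y)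
    (hf' : ∀ y, f y ≤ 1) (x : S) :
    ContinuousOn (fun t => semigroupApply P f t x) (Set.Ici 0) := by
  intro t ht
  rw [Set.mem_Ici] at ht
  have hlim : Tendsto (fun s => 2 * (1 - P |s - t| x x)) (𝓝[Set.Ici 0] t) (𝓝 0) := by
    have h1 : Tendsto (fun s => |s - t|) (𝓝[Set.Ici 0] t) (𝓝[≥] 0) := by
      refine tendsto_nhdsWithin_iff.2 ⟨?_, Eventually.of_forall fun s =>
        Set.mem_Ici.2 (abs_nonneg _)⟩
      have : ContinuousAt (fun s => |s - t|) t := by fun_prop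
      have h := this.tendsto
      simp only [sub_self, abs_zero] at h
      exact h.mono_left nhdsWithin_le_nhds
    have h2 := ((hP.tendsto_diag x).comp h1).const_sub 1 |>.const_mul 2
    simpa using h2
  rw [ContinuousWithinAt, tendsto_iff_dist_tendsto_zero]
  refine squeeze_zero' (Eventually.of_forall fun s => dist_nonneg) ?_ hlim
  filter_upwards [self_mem_nhdsWithin] with s hs
  rw [Set.mem_Ici] at hs
  rw [Real.dist_eq]
  rcases le_total s t with h | h
  · have := hP.abs_semigroupApply_add_sub_self_le hf hf' (sub_nonneg.2 h) hs x
    rw [sub_add_cancel, abs_sub_comm] at this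
    rwa [abs_sub_comm s t, abs_of_nonneg (sub_nonneg.2 h)]
  · have := hP.abs_semigroupApply_add_sub_self_le hf hf' (sub_nonneg.2 h) ht x
    rw [sub_add_cancel] at this
    rwa [abs_of_nonneg (sub_nonneg.2 h)]

/-- Kolmogorov's backward equation, for left derivatives. -/
theorem hasDerivWithinAt_semigroupApply (hP : IsTransitionFunction G P)
    (hG : IsRowFiniteGenerator G) (hf : ∀ y, 0 ≤ f y) (hf' : ∀ y, f y ≤ 1) {t : ℝ} (ht : 0 < t)
    (x : S) : HasDerivWithinAt (fun t => semigroupApply P f t x)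
      (genApply G (semigroupApply P f t) x) (Set.Iio t) t := by
  classical
  obtain ⟨s, hxs, hs0, hs⟩ := hG.exists_finset x
  rw [hasDerivWithinAt_iff_tendsto_slope' (by simp), hs]
  -- For `r ↑ t` the value at `t` is `P (t - r)` applied to the value at `r`, so derivatives of `P`
  -- at time `0` suffice.
  have hh : Tendsto (fun r => t - r) (𝓝[<] t) (𝓝[>] 0) := by
    refine tendsto_nhdsWithin_iff.2 ⟨?_, ?_⟩
    · have : ContinuousAt (fun r => t - r) t := by fun_prop
      have h := this.tendsto
      simp only [sub_self] at h
      exact h.mono_left nhdsWithin_le_nhds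
    · filter_upwards [self_mem_nhdsWithin] with r hr
      simpa using hr
  have hrate : ∀ y, Tendsto (fun r => (P (t - r) x y - P 0 x y) / (t - r)) (𝓝[<] t)
      (𝓝 (G x y)) := fun y => by
    have h1 := (hP.rates x y).mono Set.Ioi_subset_Ici_self
    rw [hasDerivWithinAt_iff_tendsto_slope' (by simp)] at h1
    have h2 := h1.comp hh
    simp only [Function.comp_def, slope_def_field, sub_zero] at h2
    exact h2
  have hcont : ∀ y, Tendsto (fun r => semigroupApply P f r y) (𝓝[<] t)
      (𝓝 (semigroupApply P f t y)) := fun y =>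
    ((hP.continuousOn_semigroupApply hf hf' y).continuousAt (Ici_mem_nhds ht)).tendsto.mono_left
      nhdsWithin_le_nhds
  have hmain := tendsto_finsetSum s fun y _ => (hrate y).mul (hcont y)
  -- The rates out of `x` sum to zero over `s`, so the probability of lying outside `s` after time
  -- `t - r` is `o(t - r)`.
  have herr := tendsto_finsetSum s fun y _ => hrate y
  rw [hs0] at herr
  have hpos : ∀ᶠ r in 𝓝[<] t, 0 < r ∧ r < t := by
    filter_upwards [self_mem_nhdsWithin, mem_nhdsWithin_of_mem_nhds (Ioi_mem_nhds ht)] with r h1 h2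
    exact ⟨h2, h1⟩
  have hP0 : ∀ g : S → ℝ, ∑ y ∈ s, P 0 x y * g y = g x := fun g => by
    rw [Finset.sum_eq_single x, hP.zero_apply, one_mul]
    · intro y _ hy
      rw [hP.zero_apply_of_ne hy.symm, zero_mul]
    · exact fun h => (h hxs).elim
  have hdiff : Tendsto (fun r => slope (fun t => semigroupApply P f t x) t r -
      ∑ y ∈ s, (P (t - r) x y - P 0 x y) / (t - r) * semigroupApply P f r y) (𝓝[<] t) (𝓝 0) := by
    rw [tendsto_zero_iff_abs_tendsto_zero]
    refine squeeze_zero' (Eventually.of_forall fun r => abs_nonneg _) ?_ (by simpa using herr.neg)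
    filter_upwards [hpos] with r hr
    have hr' : 0 < t - r := sub_pos.2 hr.2
    have h1 := hP.abs_semigroupApply_add_sub_le hf hf' hr'.le hr.1.le x s
    rw [sub_add_cancel] at h1
    have e1 : slope (fun t => semigroupApply P f t x) t r -
        ∑ y ∈ s, (P (t - r) x y - P 0 x y) / (t - r) * semigroupApply P f r y =
        (semigroupApply P f t x - ∑ y ∈ s, P (t - r) x y * semigroupApply P f r y) / (t - r) := by
      have : ∑ y ∈ s, (P (t - r) x y - P 0 x y) / (t - r) * semigroupApply P f r y =
          (∑ y ∈ s, P (t - r) x y * semigroupApply P f r y - semigroupApply P f r x) / (t - r) := by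
        rw [← hP0 (semigroupApply P f r), ← Finset.sum_sub_distrib, Finset.sum_div]
        exact Finset.sum_congr rfl fun y _ => by ring
      rw [this, slope_comm, slope_def_field]
      ring
    have e2 : -∑ y ∈ s, (P (t - r) x y - P 0 x y) / (t - r) =
        (1 - ∑ y ∈ s, P (t - r) x y) / (t - r) := by
      have h2 := hP0 fun _ => 1
      simp only [mul_one] at h2
      rw [← Finset.sum_div, Finset.sum_sub_distrib, h2]
      ring
    rw [Function.comp_apply, e1, e2, abs_div, abs_of_pos hr']
    gcongr
  simpa using hdiff.add hmain

/-- Comparison principle: a nonnegative supersolution of the backward equation dominates the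
semigroup, provided that a Lyapunov function rules out explosion. -/
theorem semigroupApply_le_of_supersolution (hP : IsTransitionFunction G P)
    (hG : IsRowFiniteGenerator G) (hf : ∀ y, 0 ≤ f y) (hf' : ∀ y, f y ≤ 1)
    {V : S → ℝ} {Λ : ℝ} (hV : ∀ x, 0 ≤ V x) (hVfin : ∀ R : ℝ, {x | V x ≤ R}.Finite)
    (hΛ : 0 ≤ Λ) (hVΛ : ∀ x, genApply G V x ≤ Λ)
    {W W' : ℝ → S → ℝ} (hW : ∀ t, 0 ≤ t → ∀ x, 0 ≤ W t x)
    (hWderiv : ∀ t x, HasDerivAt (fun t => W t x) (W' t x) t)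
    (hWsuper : ∀ t, 0 ≤ t → ∀ x, genApply G (W t) x ≤ W' t x)
    (hW0 : ∀ x, f x ≤ W 0 x) {T : ℝ} (hT : 0 ≤ T) (x : S) :
    semigroupApply P f T x ≤ W T x := by
  suffices h : ∀ ε : ℝ, 0 < ε →
      semigroupApply P f T x ≤ W T x + ε * (V x + (Λ + 1) * T) by
    have h0 : Tendsto (fun ε : ℝ => W T x + ε * (V x + (Λ + 1) * T)) (𝓝[>] 0)
        (𝓝 (W T x + 0 * (V x + (Λ + 1) * T))) :=
      ((by fun_prop : Continuous fun ε : ℝ => W T x + ε * (V x + (Λ + 1) * T)).tendsto 0).mono_left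
        nhdsWithin_le_nhds
    rw [zero_mul, add_zero] at h0
    refine ge_of_tendsto h0 ?_
    filter_upwards [self_mem_nhdsWithin] with ε hε using h ε hε
  intro ε hε
  by_contra! hcon
  -- The penalty makes `w` negative outside a finite set of states. The `+ 1` in `Λ + 1` makes the
  -- final inequality strict.
  set w : ℝ → S → ℝ := fun t y => semigroupApply P f t y - W t y - ε * (V y + (Λ + 1) * t) with hw
  have hwx : 0 < w T x := by simp only [hw]; linarith
  have hout : ∀ t, 0 ≤ t → ∀ y, 1 / ε < V y → w t y < 0 := fun t ht y hy => by
    have h1 := hP.semigroupApply_le_one hf hf' ht y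
    have h2 := hW t ht y
    have h3 : 1 < ε * V y := by rwa [div_lt_iff₀' hε] at hy
    have h4 : 0 ≤ ε * ((Λ + 1) * t) := by positivity
    simp only [hw]; nlinarith
  have hfin := hVfin (1 / ε)
  have hxF : x ∈ hfin.toFinset := by
    rw [Set.Finite.mem_toFinset, Set.mem_ofPred_eq]
    by_contra! h
    exact absurd (hout T hT x h) (not_lt.2 hwx.le)
  have hcont : ∀ y, ContinuousOn (fun t => w t y) (Set.Icc 0 T) := fun y => by
    refine (((hP.continuousOn_semigroupApply hf hf' y).mono Set.Icc_subset_Ici_self).sub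
      (fun t _ => (hWderiv t y).continuousAt.continuousWithinAt)).sub ?_
    fun_prop
  choose τ hτ hτmax using fun y =>
    isCompact_Icc.exists_isMaxOn (Set.nonempty_Icc.2 hT) (hcont y)
  obtain ⟨y, -, hymax⟩ := hfin.toFinset.exists_max_image (fun y => w (τ y) y) ⟨x, hxF⟩
  have hpos : 0 < w (τ y) y := hwx.trans_le
    ((hτmax x (Set.right_mem_Icc.2 hT)).trans (hymax x hxF))
  have hmax : ∀ t ∈ Set.Icc 0 T, ∀ z, w t z ≤ w (τ y) y := fun t ht z => by
    by_cases hz : V z ≤ 1 / ε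
    · exact (hτmax z ht).trans (hymax z (by simpa using hz))
    · exact ((hout t ht.1 z (not_le.1 hz)).trans hpos).le
  have hτ0 : 0 < τ y := by
    refine (hτ y).1.lt_of_ne fun h => ?_
    rw [← h] at hpos
    simp only [hw, hP.semigroupApply_zero, mul_zero, add_zero] at hpos
    linarith [hW0 y, mul_nonneg hε.le (hV y)]
  have hderiv : HasDerivWithinAt (fun t => w t y)
      (genApply G (semigroupApply P f (τ y)) y - W' (τ y) y - ε * (Λ + 1)) (Set.Iio (τ y)) (τ y) := by
    refine ((hP.hasDerivWithinAt_semigroupApply hG hf hf' hτ0 y).sub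
      (hWderiv (τ y) y).hasDerivWithinAt).sub ?_
    have : HasDerivAt (fun t => ε * (V y + (Λ + 1) * t)) (ε * ((Λ + 1) * 1)) (τ y) :=
      (((hasDerivAt_id _).const_mul _).const_add _).const_mul _
    rw [mul_one] at this
    exact this.hasDerivWithinAt
  -- At a maximum over `[0, T]`, attained at a positive time, the left derivative is nonnegative.
  have hge : 0 ≤ genApply G (semigroupApply P f (τ y)) y - W' (τ y) y - ε * (Λ + 1) := by
    rw [hasDerivWithinAt_iff_tendsto_slope' (by simp)] at hderiv
    refine ge_of_tendsto hderiv ?_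
    filter_upwards [self_mem_nhdsWithin, mem_nhdsWithin_of_mem_nhds (Ioi_mem_nhds hτ0)] with r h1 h2
    rw [slope_comm, slope_def_field]
    have h1 : r < τ y := h1
    refine div_nonneg (sub_nonneg.2 (hmax r ⟨le_of_lt h2, (h1.trans_le (hτ y).2).le⟩ y))
      (sub_pos.2 h1).le
  have hgen : genApply G (w (τ y)) y = genApply G (semigroupApply P f (τ y)) y
      - genApply G (W (τ y)) y - ε * genApply G V y := by
    -- The part of the penalty linear in time is constant in the state, so the generator kills it.
    obtain ⟨s, -, hs0, hs⟩ := hG.exists_finset y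
    rw [hs, hs, hs, hs, Finset.mul_sum, ← Finset.sum_sub_distrib, ← Finset.sum_sub_distrib,
      ← sub_zero (∑ z ∈ s, (_ - _ - _)),
      ← mul_zero (ε * ((Λ + 1) * τ y)), ← hs0, Finset.mul_sum, ← Finset.sum_sub_distrib]
    refine Finset.sum_congr rfl fun z _ => ?_
    simp only [hw]; ring
  -- The generator of `w` is nonpositive at the maximum, which forces the left derivative to be at
  -- most `-ε`.
  have := hG.genApply_nonpos_of_isMax (hmax (τ y) (hτ y))
  have h5 := hWsuper (τ y) hτ0.le y
  have h6 := mul_le_mul_of_nonneg_left (hVΛ y) hε.le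
  nlinarith

end IsTransitionFunction

/-! ### The Poisson equation of the background process. -/

section Poisson

variable {d : ℕ} {Q : Matrix (Fin d) (Fin d) ℝ}

/-- A harmonic vector attaining its maximum at a state attains it at all successors of that state;
irreducibility spreads this to every state. -/
theorem IsIrreducibleRateMatrix.eq_const_of_mulVec_eq_zero (hQ : IsIrreducibleRateMatrix Q)
    {h : Fin d → ℝ} (hh : Q.mulVec h = 0) (i j : Fin d) : h i = h j := by
  have : Nonempty (Fin d) := ⟨i⟩
  obtain ⟨m, hm⟩ := Finite.exists_max h
  have key : ∀ j, h j = h m := by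
    intro j
    induction hQ.irreducible m j with
    | refl => rfl
    | @tail a b _ hab ih =>
      have h0 : ∑ l, Q a l * (h m - h l) = 0 := by
        have h1 : ∑ l, Q a l * h l = 0 := congrFun hh a
        simp only [mul_sub, Finset.sum_sub_distrib, h1, ← Finset.sum_mul, hQ.row_sum, zero_mul,
          sub_zero]
      rw [Finset.sum_eq_zero_iff_of_nonneg] at h0
      · have h2 := h0 b (Finset.mem_univ b)
        rcases mul_eq_zero.1 h2 with h3 | h3
        · exact absurd h3 hab.2.ne'
        · linarith
      · intro l _
        rcases eq_or_ne a l with rfl | hal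
        · rw [ih, sub_self, mul_zero]
        · exact mul_nonneg (hQ.offDiag_nonneg a l hal) (sub_nonneg.2 (hm l))
  rw [key i, key j]

/-- The Poisson equation of an irreducible rate matrix is solvable for centred right-hand sides. -/
theorem IsIrreducibleRateMatrix.exists_mulVec_eq (hQ : IsIrreducibleRateMatrix Q)
    {π : Fin d → ℝ} (hπ : IsStationaryVector Q π) {g : Fin d → ℝ} (hg : ∑ i, π i * g i = 0) :
    ∃ h, Q.mulVec h = g := by
  let φ : (Fin d → ℝ) →ₗ[ℝ] ℝ := dotProductBilin ℝ ℝ π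
  have hφ : ∀ v, φ v = π ⬝ᵥ v := fun v => rfl
  have hle : LinearMap.range (Matrix.toLin' Q) ≤ LinearMap.ker φ := by
    rintro _ ⟨v, rfl⟩
    rw [LinearMap.mem_ker, hφ, Matrix.toLin'_apply, Matrix.dotProduct_mulVec, hπ.invariant,
      zero_dotProduct]
  have hsurj : LinearMap.range φ = ⊤ := by
    refine LinearMap.range_eq_top.2 fun a => ⟨fun _ => a, ?_⟩
    rw [hφ, dotProduct, ← Finset.sum_mul, hπ.sum_one, one_mul]
  have hker : LinearMap.ker (Matrix.toLin' Q) ≤ Submodule.span ℝ {fun _ => (1 : ℝ)} := by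
    intro v hv
    rw [LinearMap.mem_ker, Matrix.toLin'_apply] at hv
    rw [Submodule.mem_span_singleton]
    rcases isEmpty_or_nonempty (Fin d) with hd | ⟨⟨i⟩⟩
    · exact ⟨0, Subsingleton.elim _ _⟩
    · exact ⟨v i, funext fun j => by
        simpa using hQ.eq_const_of_mulVec_eq_zero hv i j⟩
  -- The kernel of `Q` has dimension at most one and the kernel of `φ` has codimension one, so the
  -- inclusion `hle` is an equality.
  have hrank : Module.finrank ℝ (LinearMap.ker φ) ≤
      Module.finrank ℝ (LinearMap.range (Matrix.toLin' Q)) := by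
    have h1 := LinearMap.finrank_range_add_finrank_ker φ
    have h2 := LinearMap.finrank_range_add_finrank_ker (Matrix.toLin' Q)
    have h3 := Submodule.finrank_mono hker
    have h4 := finrank_span_le_card (R := ℝ) ({fun _ => (1 : ℝ)} : Set (Fin d → ℝ))
    rw [hsurj, finrank_top, Module.finrank_self] at h1
    simp only [Set.toFinset_singleton, Finset.card_singleton] at h4
    omega
  have heq := Submodule.eq_of_le_of_finrank_le hle hrank
  have : g ∈ LinearMap.range (Matrix.toLin' Q) := by
    rw [heq, LinearMap.mem_ker, hφ]
    exact hg
  obtain ⟨h, hh⟩ := this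
  exact ⟨h, by rw [← hh, Matrix.toLin'_apply]⟩

theorem IsIrreducibleRateMatrix.exists_poisson (hQ : IsIrreducibleRateMatrix Q)
    {π : Fin d → ℝ} (hπ : IsStationaryVector Q π) (k : Fin d) :
    ∃ h : Fin d → ℝ, ∀ i, ∑ j, Q i j * h j = (if i = k then 1 else 0) - π k := by
  obtain ⟨h, hh⟩ := hQ.exists_mulVec_eq hπ (g := fun i => (if i = k then 1 else 0) - π k) (by
    simp only [mul_sub, Finset.sum_sub_distrib, ← Finset.sum_mul, hπ.sum_one]
    simp)
  exact ⟨h, fun i => congrFun hh i⟩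

end Poisson

/-! ### The generator of Model II. -/

section Generator

variable {d : ℕ} {Q : Matrix (Fin d) (Fin d) ℝ} {lam mu : Fin d → ℝ}

theorem hasSum_modelIIRate_mul (Q : Matrix (Fin d) (Fin d) ℝ) (lam mu : Fin d → ℝ)
    (F : (Fin d → ℕ) × Fin d → ℝ) (x : (Fin d → ℕ) × Fin d) :
    HasSum (fun y => modelIIRate Q lam mu x y * F y)
      (∑ j, Q x.2 j * F (x.1, j) + lam x.2 * F (x.1 + Pi.single x.2 1, x.2)
        + ∑ k, mu k * (x.1 k : ℝ) * F (x.1 - Pi.single k 1, x.2)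
        - (lam x.2 + ∑ k, mu k * (x.1 k : ℝ)) * F x) := by
  have hs : ∀ (a : (Fin d → ℕ) × Fin d) (c : ℝ),
      HasSum (fun y => (if y = a then c else 0) * F y) (c * F a) := fun a c => by
    have h := hasSum_single (f := fun y => (if y = a then c else 0) * F y) a
      fun y hy => by simp [hy]
    simpa using h
  have h1 : HasSum (fun y : (Fin d → ℕ) × Fin d => (if y.1 = x.1 then Q x.2 y.2 else 0) * F y)
      (∑ j, Q x.2 j * F (x.1, j)) := by
    have hinj : Function.Injective fun j : Fin d => (x.1, j) := fun a b hab => by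
      simpa using hab
    refine (hinj.hasSum_iff fun y hy => ?_).1 ?_
    · rw [if_neg, zero_mul]
      rintro h
      exact hy ⟨y.2, by simp [← h]⟩
    · convert hasSum_fintype _ using 2
      simp
  have h3 : HasSum (fun y : (Fin d → ℕ) × Fin d =>
      (∑ k, if y.1 + Pi.single k 1 = x.1 ∧ y.2 = x.2 then mu k * (x.1 k : ℝ) else 0) * F y)
      (∑ k, mu k * (x.1 k : ℝ) * F (x.1 - Pi.single k 1, x.2)) := by
    simp only [Finset.sum_mul]
    refine hasSum_sum fun k _ => ?_
    refine (hs (x.1 - Pi.single k 1, x.2) (mu k * (x.1 k : ℝ))).congr_fun ?_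
    intro y
    congr 1
    -- With no type-`k` job the natural-number subtraction truncates, but the departure rate is then
    -- zero.
    by_cases hk : x.1 k = 0
    · simp [hk]
    · have : (y.1 + Pi.single k 1 = x.1 ∧ y.2 = x.2) ↔ y = (x.1 - Pi.single k 1, x.2) := by
        have hle : Pi.single k 1 ≤ x.1 := by
          intro l
          rcases eq_or_ne l k with rfl | hl
          · simpa using Nat.one_le_iff_ne_zero.2 hk
          · simp [hl]
        rw [Prod.ext_iff, eq_tsub_iff_add_eq_of_le hle]
      simp only [this]
  have h := ((h1.add (hs (x.1 + Pi.single x.2 1, x.2) (lam x.2))).add h3).sub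
    (hs x (lam x.2 + ∑ k, mu k * (x.1 k : ℝ)))
  refine h.congr_fun fun y => ?_
  rw [modelIIRate]
  ring

theorem genApply_modelIIRate (Q : Matrix (Fin d) (Fin d) ℝ) (lam mu : Fin d → ℝ)
    (F : (Fin d → ℕ) × Fin d → ℝ) (x : (Fin d → ℕ) × Fin d) :
    genApply (modelIIRate Q lam mu) F x = ∑ j, Q x.2 j * F (x.1, j)
      + lam x.2 * (F (x.1 + Pi.single x.2 1, x.2) - F x)
      + ∑ k, mu k * (x.1 k : ℝ) * (F (x.1 - Pi.single k 1, x.2) - F x) := by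
  rw [genApply, (hasSum_modelIIRate_mul Q lam mu F x).tsum_eq]
  simp only [mul_sub, Finset.sum_sub_distrib, ← Finset.sum_mul]
  ring

theorem isRowFiniteGenerator_modelIIRate (hQ : ∀ i j, i ≠ j → 0 ≤ Q i j)
    (hQ' : ∀ i, ∑ j, Q i j = 0) (hlam : ∀ k, 0 ≤ lam k) (hmu : ∀ k, 0 ≤ mu k) :
    IsRowFiniteGenerator (modelIIRate Q lam mu) where
  finite_support x := by
    refine (((Set.finite_range fun j : Fin d => (x.1, j)).union
      ((Set.finite_singleton (x.1 + Pi.single x.2 1, x.2)).union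
      (Set.finite_singleton x))).union
      (Set.finite_range fun k : Fin d => (x.1 - Pi.single k 1, x.2))).subset fun y hy => ?_
    by_contra h
    simp only [Set.mem_union, Set.mem_range, Set.mem_singleton_iff, not_or, not_exists] at h
    obtain ⟨⟨h1, h2, h3⟩, h4⟩ := h
    refine hy ?_
    rw [modelIIRate, if_neg, if_neg h2, if_neg h3, Finset.sum_eq_zero]
    · simp
    · intro k _
      refine if_neg fun h => h4 k ?_
      rw [← h.1, ← h.2, add_tsub_cancel_right]
    · exact fun h => h1 y.2 (by rw [← h])
  offDiag_nonneg x y hxy := by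
    rw [modelIIRate, if_neg hxy.symm, sub_zero]
    refine add_nonneg (add_nonneg ?_ ?_) (Finset.sum_nonneg fun k _ => ?_)
    · split_ifs with h
      · exact hQ _ _ fun h' => hxy (Prod.ext h.symm h')
      · exact le_rfl
    · split_ifs
      · exact hlam _
      · exact le_rfl
    · split_ifs
      · exact mul_nonneg (hmu k) (Nat.cast_nonneg _)
      · exact le_rfl
  row_sum x := by
    have h := hasSum_modelIIRate_mul Q lam mu (fun _ => 1) x
    simp only [mul_one, hQ'] at h
    convert h using 1
    ring

/-- The generator applied to a function of the number of type-`k` jobs and the background state. -/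
theorem genApply_modelIIRate_coord (Q : Matrix (Fin d) (Fin d) ℝ) (lam mu : Fin d → ℝ)
    (Φ : ℝ → Fin d → ℝ) (k : Fin d) (x : (Fin d → ℕ) × Fin d) :
    genApply (modelIIRate Q lam mu) (fun y => Φ (y.1 k) y.2) x = ∑ j, Q x.2 j * Φ (x.1 k) j
      + (if x.2 = k then 1 else 0) * lam k * (Φ (x.1 k + 1) x.2 - Φ (x.1 k) x.2)
      + mu k * x.1 k * (Φ (x.1 k - 1) x.2 - Φ (x.1 k) x.2) := by
  rw [genApply_modelIIRate]
  congr 1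
  · congr 1
    split_ifs with h
    · simp [h]
    · have h' : k ≠ x.2 := fun h' => h h'.symm
      simp [h']
  · rw [Finset.sum_eq_single k]
    · rcases Nat.eq_zero_or_pos (x.1 k) with h | h
      · simp [h]
      · simp [Nat.cast_sub (show 1 ≤ x.1 k from h)]
    · intro l _ hl
      simp [hl.symm]
    · simp

/-- Lyapunov bound: background jumps do not change the total number of jobs, departures lower it,
and only arrivals raise it. -/
theorem genApply_modelIIRate_sum_le (hQ : ∀ i j, i ≠ j → 0 ≤ Q i j)
    (hQ' : ∀ i, ∑ j, Q i j = 0) (hlam : ∀ k, 0 ≤ lam k) (hmu : ∀ k, 0 ≤ mu k)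
    (x : (Fin d → ℕ) × Fin d) :
    genApply (modelIIRate Q lam mu) (fun y => ∑ k, (y.1 k : ℝ)) x ≤ ∑ k, lam k := by
  have hG := isRowFiniteGenerator_modelIIRate hQ hQ' hlam hmu
  have hsum : genApply (modelIIRate Q lam mu) (fun y => ∑ k, (y.1 k : ℝ)) x =
      ∑ k, genApply (modelIIRate Q lam mu) (fun y => (y.1 k : ℝ)) x := by
    obtain ⟨s, -, -, hs⟩ := hG.exists_finset x
    simp only [hs, Finset.mul_sum]
    exact Finset.sum_comm
  rw [hsum]
  refine Finset.sum_le_sum fun k _ => ?_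
  rw [genApply_modelIIRate_coord Q lam mu (fun m _ => m) k x, ← Finset.sum_mul, hQ']
  have h1 : 0 ≤ mu k * (x.1 k : ℝ) := mul_nonneg (hmu k) (Nat.cast_nonneg _)
  have h2 := hlam k
  split_ifs <;> nlinarith

theorem finite_setOf_sum_le (R : ℝ) :
    {x : (Fin d → ℕ) × Fin d | ∑ k, (x.1 k : ℝ) ≤ R}.Finite := by
  refine ((Set.finite_Icc (0 : Fin d → ℕ) fun _ => ⌊R⌋₊).prod (Set.finite_univ (α := Fin d))).subset
    fun x hx => ?_
  refine ⟨⟨fun k => Nat.zero_le _, fun k => Nat.le_floor ?_⟩, Set.mem_univ _⟩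
  exact (Finset.single_le_sum (f := fun k => (x.1 k : ℝ)) (fun k _ => Nat.cast_nonneg _)
    (Finset.mem_univ k)).trans hx

end Generator

/-! ### The quadratic supersolution. -/

/-- The additive error of the quadratic supersolution, where `th = N ^ (-α)` and `ν = 1 / N`. -/
noncomputable def superErr (lam mu H C th ν : ℝ) : ℝ :=
  4 * th ^ 2 * lam ^ 2 * H + (2 * lam * ν + th * lam ^ 2 * C) / mu

/-- A quadratic supersolution of the backward equation: `e = exp (-μ t)`, `x` is the scaled number
of jobs, `η` is the value of the solution of a Poisson equation at the background state, and the
limit to compare with is `c`. -/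
def superSol (lam r c th ν D e x η : ℝ) : ℝ :=
  (2 - e) * (x * e + r * (1 - e) - c - th * lam * e * η) ^ 2 + 2 * x * (e - e ^ 2) * ν
    + (1 - e) * D

/-- The derivative of `superSol` with respect to `e`. -/
def superSolDeriv (lam r c th ν D e x η : ℝ) : ℝ :=
  -(x * e + r * (1 - e) - c - th * lam * e * η) ^ 2
    + (2 - e) * (2 * (x * e + r * (1 - e) - c - th * lam * e * η) * (x - r - th * lam * η))
    + 2 * x * (1 - 2 * e) * ν - D

theorem hasDerivAt_superSol (lam r c th ν D e x η : ℝ) :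
    HasDerivAt (fun e => superSol lam r c th ν D e x η) (superSolDeriv lam r c th ν D e x η) e := by
  have hid := hasDerivAt_id e
  have hB : HasDerivAt (fun e => x * e + r * (1 - e) - c - th * lam * e * η)
      (x * 1 + r * (-1) - th * lam * 1 * η) e :=
    (((hid.const_mul x).add ((hid.const_sub 1).const_mul r)).sub_const c).sub
      ((hid.const_mul (th * lam)).mul_const η)
  have h := (((hid.const_sub 2).mul (hB.pow 2)).add
    (((hid.sub (hid.pow 2)).const_mul (2 * x)).mul_const ν)).add ((hid.const_sub 1).mul_const D)
  refine h.congr_deriv ?_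
  simp only [superSolDeriv, id, Pi.pow_apply]
  push_cast
  ring

theorem superErr_nonneg {lam mu H C th ν : ℝ} (hlam : 0 ≤ lam) (hmu : 0 < mu) (hH : 0 ≤ H)
    (hC : 0 ≤ C) (hth : 0 ≤ th) (hν : 0 ≤ ν) : 0 ≤ superErr lam mu H C th ν := by
  unfold superErr; positivity

theorem superSol_nonneg {lam r c th ν D e x η : ℝ} (hν : 0 ≤ ν) (hD : 0 ≤ D) (he : 0 ≤ e)
    (he' : e ≤ 1) (hx : 0 ≤ x) : 0 ≤ superSol lam r c th ν D e x η := by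
  have h1 : 0 ≤ 2 - e := by linarith
  have h2 : 0 ≤ e - e ^ 2 := by nlinarith
  have h3 : 0 ≤ 1 - e := by linarith
  unfold superSol; positivity

/-- The drift inequality that makes `superSol` a supersolution. -/
theorem superSol_drift {lam mu p c th ν n q e x η σ S H C δ : ℝ} (hlam : 0 ≤ lam) (hmu : 0 < mu)
    (hth : 0 ≤ th) (hν : 0 ≤ ν) (hn : n * ν = 1) (hq : q * th = 1) (he : 0 ≤ e) (he' : e ≤ 1)
    (hx : 0 ≤ x) (hη : η ^ 2 ≤ H) (hσ : σ = δ - p) (hS : S - 2 * η * σ ≤ C) (hC : 0 ≤ C)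
    (hδ' : δ ≤ 1) :
    (2 - e) * q * (-2 * (x * e + p * (lam / mu) * (1 - e) - c) * th * lam * e * σ
        + th ^ 2 * lam ^ 2 * e ^ 2 * S)
      + δ * (n * lam) * (superSol lam (p * (lam / mu)) c th ν (superErr lam mu H C th ν) e (x + ν) η
        - superSol lam (p * (lam / mu)) c th ν (superErr lam mu H C th ν) e x η)
      + mu * (n * x) * (superSol lam (p * (lam / mu)) c th ν (superErr lam mu H C th ν) e (x - ν) η
        - superSol lam (p * (lam / mu)) c th ν (superErr lam mu H C th ν) e x η)
      ≤ superSolDeriv lam (p * (lam / mu)) c th ν (superErr lam mu H C th ν) e x η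
        * (-(mu * e)) := by
  have hD : mu * superErr lam mu H C th ν =
      mu * (4 * th ^ 2 * lam ^ 2 * H) + (2 * lam * ν + th * lam ^ 2 * C) := by
    unfold superErr; field_simp
  set D := superErr lam mu H C th ν
  obtain ⟨r, hr⟩ : ∃ r, r = p * (lam / mu) := ⟨_, rfl⟩
  have hr' : mu * r = p * lam := by rw [hr]; field_simp
  rw [← hr]
  -- In terms of the corrected deviation `B`, the drifts of the jobs and of the corrector add up to
  -- the averaged drift.
  obtain ⟨B, hB⟩ : ∃ B, B = x * e + r * (1 - e) - c - th * lam * e * η := ⟨_, rfl⟩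
  have hA : ∀ s, superSol lam r c th ν D e (x + s) η - superSol lam r c th ν D e x η =
      (2 - e) * (2 * B * e * s + e ^ 2 * s ^ 2) + 2 * s * (e - e ^ 2) * ν := fun s => by
    rw [hB]; unfold superSol; ring
  have hA1 : δ * (n * lam) * (superSol lam r c th ν D e (x + ν) η
      - superSol lam r c th ν D e x η) =
      δ * lam * ((2 - e) * (2 * B * e + e ^ 2 * ν) + 2 * (e - e ^ 2) * ν) := by
    rw [hA]; linear_combination
      (δ * lam * ((2 - e) * (2 * B * e + e ^ 2 * ν) + 2 * (e - e ^ 2) * ν)) * hn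
  have hA2 : mu * (n * x) * (superSol lam r c th ν D e (x - ν) η
      - superSol lam r c th ν D e x η) =
      mu * x * ((2 - e) * (-(2 * B * e) + e ^ 2 * ν) - 2 * (e - e ^ 2) * ν) := by
    rw [sub_eq_add_neg x, hA]; linear_combination
      (mu * x * ((2 - e) * (-(2 * B * e) + e ^ 2 * ν) - 2 * (e - e ^ 2) * ν)) * hn
  have hA3 : (2 - e) * q * (-2 * (x * e + r * (1 - e) - c) * th * lam * e * σ
        + th ^ 2 * lam ^ 2 * e ^ 2 * S) =
      (2 - e) * (-2 * B * lam * e * σ + th * lam ^ 2 * e ^ 2 * (S - 2 * η * σ)) := by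
    rw [hB]; linear_combination ((2 - e) * (-2 * (x * e + r * (1 - e) - c) * lam * e * σ
        + th * lam ^ 2 * e ^ 2 * S)) * hq
  rw [hA1, hA2, hA3, superSolDeriv, ← hB]
  have e1 : 0 ≤ 2 - e := by linarith
  -- The factor `2 - e` contributes `mu * e * B ^ 2` to the time derivative; it completes the square
  -- with the cross term from the decay of the corrector. The cost `t2` is the first term of
  -- `superErr`.
  have t1 : 0 ≤ mu * e * (B + (2 - e) * (th * lam * η)) ^ 2 := by positivity
  have t2 : mu * e * ((2 - e) ^ 2 * (th ^ 2 * lam ^ 2 * η ^ 2)) ≤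
      mu * e * (4 * (th ^ 2 * lam ^ 2 * H)) := by
    have : (2 - e) ^ 2 ≤ 4 := (pow_le_pow_left₀ e1 (by linarith : 2 - e ≤ 2) 2).trans (by norm_num)
    gcongr
  -- `S - 2 * η * σ` is the carré du champ of the Poisson solution. One factor `e` is kept to match
  -- the derivative of `(1 - e) * D`.
  have t3 : (2 - e) * (th * lam ^ 2 * e ^ 2 * (S - 2 * η * σ)) ≤ e * (th * lam ^ 2 * C) := by
    have h1 : (2 - e) * (th * lam ^ 2 * e ^ 2 * (S - 2 * η * σ)) ≤
        (2 - e) * (th * lam ^ 2 * e ^ 2 * C) := by gcongr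
    have h2 : (2 - e) * e ≤ 1 := by linear_combination sq_nonneg (1 - e)
    have h3 := mul_le_mul_of_nonneg_right h2 (show 0 ≤ e * (th * lam ^ 2 * C) by positivity)
    linarith
  -- The binomial-type term `2 * x * (e - e ^ 2) * ν` pays for the departure noise and leaves
  -- exactly this surplus; `t5` is the arrival noise.
  have t4 : 0 ≤ mu * x * ν * e ^ 3 := by positivity
  have t5 : δ * lam * ν * (2 * e - e ^ 3) ≤ 2 * lam * ν * e := by
    have h1 : δ * (2 * e - e ^ 3) ≤ 1 * (2 * e - e ^ 3) := by
      refine mul_le_mul_of_nonneg_right hδ' ?_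
      linarith [pow_le_of_le_one he he' three_ne_zero]
    have h2 : 0 ≤ e ^ 3 := by positivity
    have h3 := mul_le_mul_of_nonneg_left (show δ * (2 * e - e ^ 3) ≤ 2 * e by linarith)
      (mul_nonneg hlam hν)
    linarith
  subst hσ
  linear_combination t1 + t2 + t3 + t4 + t5 - e * hD - 2 * (2 - e) * B * e * hr'

/-! ### Deviation bound from an arbitrary initial state. -/

section Bound

variable {d : ℕ} {Q : Matrix (Fin d) (Fin d) ℝ} {π lam mu : Fin d → ℝ} {α : ℝ} {N : ℕ}

theorem isRowFiniteGenerator_scaledRate (hQ : IsIrreducibleRateMatrix Q) (hlam : ∀ k, 0 ≤ lam k)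
    (hmu : ∀ k, 0 < mu k) : IsRowFiniteGenerator (scaledRate Q lam mu α N) :=
  isRowFiniteGenerator_modelIIRate
    (fun i j hij => mul_nonneg (Real.rpow_nonneg (Nat.cast_nonneg N) α) (hQ.offDiag_nonneg i j hij))
    (fun i => by simp [← Finset.mul_sum, hQ.row_sum])
    (fun k => mul_nonneg (Nat.cast_nonneg N) (hlam k)) (fun k => (hmu k).le)

/-- Quantitative deviation bound for the number of type-`k` jobs from an arbitrary initial state. -/
theorem semigroupApply_indicator_le (hQ : IsIrreducibleRateMatrix Q)
    (hlam : ∀ k, 0 ≤ lam k) (hmu : ∀ k, 0 < mu k) (hN : 1 ≤ N)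
    {P : ℝ → (Fin d → ℕ) × Fin d → (Fin d → ℕ) × Fin d → ℝ}
    (hP : IsTransitionFunction (scaledRate Q lam mu α N) P) {k : Fin d} {h : Fin d → ℝ} {H C : ℝ}
    (hh : ∀ i, ∑ j, Q i j * h j = (if i = k then 1 else 0) - π k)
    (hH : ∀ i, h i ^ 2 ≤ H)
    (hC : ∀ i, ∑ j, Q i j * h j ^ 2 - 2 * h i * ((if i = k then 1 else 0) - π k) ≤ C)
    (hC0 : 0 ≤ C) {c ε : ℝ} (hε : 0 < ε)
    (hsmall : ((N : ℝ) ^ α)⁻¹ ^ 2 * lam k ^ 2 * H ≤ ε ^ 2 / 4) {t : ℝ} (ht : 0 ≤ t)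
    (x : (Fin d → ℕ) × Fin d) :
    semigroupApply P ({y | ε ≤ |(y.1 k : ℝ) / N - c|}.indicator 1) t x ≤
      4 / ε ^ 2 * superSol (lam k) (rho π lam mu k) c ((N : ℝ) ^ α)⁻¹ (N : ℝ)⁻¹
        (superErr (lam k) (mu k) H C ((N : ℝ) ^ α)⁻¹ (N : ℝ)⁻¹)
        (Real.exp (-(mu k * t))) ((x.1 k : ℝ) / N) (h x.2) := by
  have hN0 : 0 < (N : ℝ) := by exact_mod_cast hN
  have hq : 0 < (N : ℝ) ^ α := Real.rpow_pos_of_pos hN0 α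
  have hqth : (N : ℝ) ^ α * ((N : ℝ) ^ α)⁻¹ = 1 := mul_inv_cancel₀ hq.ne'
  have hnν : (N : ℝ) * (N : ℝ)⁻¹ = 1 := mul_inv_cancel₀ hN0.ne'
  obtain ⟨q, hqdef⟩ : ∃ q, q = (N : ℝ) ^ α := ⟨_, rfl⟩
  rw [← hqdef] at hq hqth hsmall ⊢
  set th := q⁻¹ with hth
  set ν := (N : ℝ)⁻¹ with hν
  have hth0 : 0 ≤ th := (inv_pos.2 hq).le
  have hν0 : 0 ≤ ν := (inv_pos.2 hN0).le
  have hH0 : 0 ≤ H := (sq_nonneg _).trans (hH k)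
  have hD := superErr_nonneg (hlam k) (hmu k) hH0 hC0 hth0 hν0
  set D := superErr (lam k) (mu k) H C th ν with hDdef
  set Φ : ℝ → ℝ → Fin d → ℝ := fun e m i =>
    superSol (lam k) (rho π lam mu k) c th ν D e (m * ν) (h i) with hΦ
  have hG := isRowFiniteGenerator_scaledRate (α := α) (N := N) hQ hlam hmu
  have hexp : ∀ s : ℝ, 0 ≤ s → Real.exp (-(mu k * s)) ≤ 1 := fun s hs =>
    Real.exp_le_one_iff.2 (neg_nonpos.2 (mul_nonneg (hmu k).le hs))
  have key := hP.semigroupApply_le_of_supersolution hG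
    (f := {y | ε ≤ |(y.1 k : ℝ) / N - c|}.indicator 1)
    (fun y => Set.indicator_nonneg (fun _ _ => zero_le_one) y)
    (fun y => Set.indicator_le_self' (fun _ _ => zero_le_one) y)
    (V := fun y => ∑ l, (y.1 l : ℝ)) (Λ := ∑ l, N * lam l)
    (fun y => Finset.sum_nonneg fun l _ => Nat.cast_nonneg _)
    finite_setOf_sum_le
    (Finset.sum_nonneg fun l _ => mul_nonneg hN0.le (hlam l))
    (genApply_modelIIRate_sum_le
      (fun i j hij => mul_nonneg (Real.rpow_nonneg hN0.le α) (hQ.offDiag_nonneg i j hij))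
      (fun i => by simp [← Finset.mul_sum, hQ.row_sum])
      (fun l => mul_nonneg hN0.le (hlam l)) (fun l => (hmu l).le))
    (W := fun s y => 4 / ε ^ 2 * Φ (Real.exp (-(mu k * s))) (y.1 k) y.2)
    (W' := fun s y => 4 / ε ^ 2 * (superSolDeriv (lam k) (rho π lam mu k) c th ν D
      (Real.exp (-(mu k * s))) (y.1 k * ν) (h y.2) * (-(mu k * Real.exp (-(mu k * s))))))
    (fun s hs y => mul_nonneg (by positivity) (superSol_nonneg hν0 hD (Real.exp_pos _).le
      (hexp s hs) (mul_nonneg (Nat.cast_nonneg _) hν0)))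
    (fun s y => by
      have h1 : HasDerivAt (fun s => Real.exp (-(mu k * s)))
          (-(mu k * Real.exp (-(mu k * s)))) s := by
        have := (((hasDerivAt_id s).const_mul (mu k)).neg).exp
        refine this.congr_deriv ?_
        simp only [id, Pi.neg_apply]; ring
      exact ((hasDerivAt_superSol _ _ _ _ _ _ _ _ _).comp s h1).const_mul _)
    (fun s hs y => ?_) (fun y => ?_) ht x
  · simpa only [hΦ, hν, ← div_eq_mul_inv] using key
  · rw [scaledRate, genApply_modelIIRate_coord _ _ _
      (fun m i => 4 / ε ^ 2 * Φ (Real.exp (-(mu k * s))) m i) k y]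
    set e := Real.exp (-(mu k * s))
    have hdrift := superSol_drift (p := π k) (c := c) (x := y.1 k * ν) (η := h y.2)
      (hlam k) (hmu k) hth0 hν0 hnν hqth (Real.exp_pos (-(mu k * s))).le (hexp s hs)
      (mul_nonneg (Nat.cast_nonneg _) hν0) (hH y.2) rfl (hC y.2) hC0
      (show (if y.2 = k then (1 : ℝ) else 0) ≤ 1 by split_ifs <;> norm_num)
    rw [← hDdef] at hdrift
    have hmul := mul_le_mul_of_nonneg_left hdrift (show 0 ≤ 4 / ε ^ 2 by positivity)
    refine le_trans (le_of_eq ?_) hmul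
    have hback : ∑ j, (((N : ℝ) ^ α) • Q) y.2 j * (4 / ε ^ 2 * Φ e (y.1 k) j) =
        4 / ε ^ 2 * ((2 - e) * q * (-2 * (y.1 k * ν * e + π k * (lam k / mu k) * (1 - e) - c)
          * th * lam k * e * ((if y.2 = k then 1 else 0) - π k)
        + th ^ 2 * lam k ^ 2 * e ^ 2 * ∑ j, Q y.2 j * h j ^ 2)) := by
      rw [← hh y.2, ← hqdef]
      obtain ⟨b, hb⟩ : ∃ b, b = y.1 k * ν * e + π k * (lam k / mu k) * (1 - e) - c := ⟨_, rfl⟩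
      -- `z` collects the terms free of the background state; the zero row sums of `Q` remove it.
      obtain ⟨z, hz⟩ : ∃ z, z = 2 * (y.1 k * ν) * (e - e ^ 2) * ν + (1 - e) * D := ⟨_, rfl⟩
      have : ∀ j, (q • Q) y.2 j * (4 / ε ^ 2 * Φ e (y.1 k) j) =
          Q y.2 j * (q * (4 / ε ^ 2) * ((2 - e) * b ^ 2 + z))
          + q * (4 / ε ^ 2) * (2 - e) * (-2 * b * th * lam k * e) * (Q y.2 j * h j)
          + q * (4 / ε ^ 2) * (2 - e) * (th ^ 2 * lam k ^ 2 * e ^ 2) * (Q y.2 j * h j ^ 2) :=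
        fun j => by
          simp only [hΦ, superSol, rho, Matrix.smul_apply, smul_eq_mul, hb, hz]
          ring
      rw [Finset.sum_congr rfl fun j _ => this j, Finset.sum_add_distrib, Finset.sum_add_distrib,
        ← Finset.sum_mul, hQ.row_sum, ← Finset.mul_sum, ← Finset.mul_sum, ← hb]
      ring
    rw [hback]
    have hm : (N : ℝ) * (y.1 k * ν) = y.1 k := by
      rw [mul_left_comm, hnν, mul_one]
    simp only [hΦ, rho, hm, add_mul, sub_mul, one_mul, Pi.smul_apply, smul_eq_mul]
    ring
  · by_cases hy : y ∈ {y : (Fin d → ℕ) × Fin d | ε ≤ |(y.1 k : ℝ) / N - c|}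
    · rw [Set.indicator_of_mem hy, Pi.one_apply]
      have hy' : ε ^ 2 ≤ ((y.1 k : ℝ) * ν - c) ^ 2 := by
        rw [← sq_abs ((y.1 k : ℝ) * ν - c), hν, ← div_eq_mul_inv]
        exact pow_le_pow_left₀ hε.le hy 2
      have h1 : th ^ 2 * lam k ^ 2 * h y.2 ^ 2 ≤ ε ^ 2 / 4 :=
        (mul_le_mul_of_nonneg_left (hH y.2) (by positivity)).trans hsmall
      simp only [hΦ, superSol, mul_zero, neg_zero, Real.exp_zero]
      rw [div_mul_eq_mul_div, le_div_iff₀ (by positivity)]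
      -- With `a` the deviation and `b` the corrector, `(a - b)² = a² / 2 - b² + (a - 2b)² / 2 ≥ ε²
      -- / 2 - ε² / 4`; hence the factor `4 / ε ^ 2`.
      nlinarith [sq_nonneg ((y.1 k : ℝ) * ν - c - 2 * (th * lam k * h y.2))]
    · rw [Set.indicator_of_notMem hy]
      exact mul_nonneg (by positivity) (superSol_nonneg hν0 hD (Real.exp_pos _).le
        (hexp 0 le_rfl) (mul_nonneg (Nat.cast_nonneg _) hν0))

end Bound

/-! ### Laws of random elements and the semigroup. -/

section Laws

variable {Ω S : Type*} [MeasurableSpace Ω] [MeasurableSpace S] {ℙ : Measure Ω} {G : S → S → ℝ}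

theorem hasSum_measureReal_inter_eq [Countable S] [MeasurableSingletonClass S]
    [IsProbabilityMeasure ℙ] {Z : Ω → S} (hZ : Measurable Z) {A : Set Ω} (hA : MeasurableSet A) :
    HasSum (fun x => ℙ.real {ω | Z ω = x ∧ ω ∈ A}) (ℙ.real A) := by
  have hmeas : ∀ x, MeasurableSet {ω | Z ω = x ∧ ω ∈ A} := fun x =>
    (hZ (measurableSet_singleton x)).inter hA
  have hU : A = ⋃ x, {ω | Z ω = x ∧ ω ∈ A} := by
    ext ω; simp
  have h1 : ℙ A = ∑' x, ℙ {ω | Z ω = x ∧ ω ∈ A} := by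
    conv_lhs => rw [hU]
    refine measure_iUnion (fun x y hxy => Set.disjoint_left.2 fun ω h1 h2 => hxy ?_) hmeas
    exact h1.1.symm.trans h2.1
  have h2 := ENNReal.hasSum_toReal (f := fun x => ℙ {ω | Z ω = x ∧ ω ∈ A})
    (by rw [← h1]; exact measure_ne_top _ _)
  rwa [← ENNReal.tsum_toReal_eq fun x => measure_ne_top _ _, ← h1] at h2

theorem hasSum_measureReal_eq [Countable S] [MeasurableSingletonClass S]
    [IsProbabilityMeasure ℙ] {Z : Ω → S} (hZ : Measurable Z) :
    HasSum (fun x => ℙ.real {ω | Z ω = x}) 1 := by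
  simpa using hasSum_measureReal_inter_eq (ℙ := ℙ) hZ MeasurableSet.univ

theorem measureReal_mem_eq_tsum [Countable S] [MeasurableSingletonClass S]
    [IsProbabilityMeasure ℙ] {Z : Ω → S} (hZ : Measurable Z) (A : Set S) :
    ℙ.real {ω | Z ω ∈ A} = ∑' y, ℙ.real {ω | Z ω = y} * A.indicator 1 y := by
  change ℙ.real (Z ⁻¹' A) = _
  rw [← (hasSum_measureReal_inter_eq (ℙ := ℙ) hZ (hZ A.to_countable.measurableSet)).tsum_eq]
  refine tsum_congr fun y => ?_
  by_cases hy : y ∈ A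
  · rw [Set.indicator_of_mem hy, Pi.one_apply, mul_one]
    congr 1
    ext ω
    simp only [Set.mem_preimage, Set.mem_ofPred_eq, and_iff_left_iff_imp]
    rintro rfl
    exact hy
  · rw [Set.indicator_of_notMem hy, mul_zero]
    convert measureReal_empty
    ext ω
    simp only [Set.mem_preimage, Set.mem_ofPred_eq, Set.mem_empty_iff_false, iff_false, not_and]
    rintro rfl
    exact hy

/-- The process enters only through the joint law at times `0` and `t`. -/
theorem IsMarkovProcess.exists_hasSum_law [Countable S] [MeasurableSingletonClass S]
    [IsProbabilityMeasure ℙ] {X : ℝ → Ω → S} (hX : IsMarkovProcess ℙ G X) {t : ℝ} (ht : 0 ≤ t) :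
    ∃ P : ℝ → S → S → ℝ, IsTransitionFunction G P ∧
      ∀ y, HasSum (fun x => ℙ.real {ω | X 0 ω = x} * P t x y) (ℙ.real {ω | X t ω = y}) := by
  obtain ⟨P, hP, hfdd⟩ := hX.markov
  refine ⟨P, hP, fun y => ?_⟩
  have h1 := hasSum_measureReal_inter_eq (ℙ := ℙ) (hX.measurable 0 le_rfl)
    (hX.measurable t ht (measurableSet_singleton y))
  refine h1.congr_fun fun x => ?_
  have h2 := hfdd 1 ![0, t] ![x, y] (by simp) (by
    refine Fin.monotone_iff_le_succ.2 fun i => ?_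
    fin_cases i
    simpa using ht)
  have h3 : {ω | ∀ i, X (![0, t] i) ω = ![x, y] i} = {ω | X 0 ω = x ∧ ω ∈ X t ⁻¹' {y}} :=
    Set.ext fun ω => Fin.forall_fin_two
  rw [h3] at h2
  simpa using h2.symm

theorem hasSum_law_mul_semigroupApply [Countable S] [MeasurableSingletonClass S]
    [IsProbabilityMeasure ℙ] {P : ℝ → S → S → ℝ} (hP : IsTransitionFunction G P) {Z Y : Ω → S}
    (hZ : Measurable Z) (hY : Measurable Y) {t : ℝ} (ht : 0 ≤ t)
    (h : ∀ y, HasSum (fun x => ℙ.real {ω | Z ω = x} * P t x y) (ℙ.real {ω | Y ω = y}))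
    (A : Set S) :
    HasSum (fun x => ℙ.real {ω | Z ω = x} * semigroupApply P (A.indicator 1) t x)
      (ℙ.real {ω | Y ω ∈ A}) := by
  rw [measureReal_mem_eq_tsum hY]
  exact hasSum_mul_kernel (fun _ => measureReal_nonneg) (hasSum_measureReal_eq hZ).summable
    (hP.nonneg t ht) (hP.sum_one t ht) h
    (fun y => Set.indicator_nonneg (fun _ _ => zero_le_one) y)
    (fun y => Set.indicator_le_self' (fun _ _ => zero_le_one) y)

end Laws

/-! ### Convergence in probability. -/

section Convergence

variable {d : ℕ} {Ω : ℕ → Type*} [∀ N, MeasurableSpace (Ω N)] {ℙ : ∀ N, Measure (Ω N)}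

theorem TendstoInProb.of_coord {X : ∀ N, Ω N → Fin d → ℝ} {c : Fin d → ℝ}
    (h : ∀ k, TendstoInProb ℙ (fun N ω => X N ω k) (c k)) : TendstoInProb ℙ X c := by
  intro ε hε
  have hsum : Tendsto (fun N => ∑ k, ℙ N {ω | ε ≤ dist (X N ω k) (c k)}) atTop (𝓝 0) := by
    simpa using tendsto_finsetSum Finset.univ fun k _ => h k ε hε
  refine tendsto_of_tendsto_of_tendsto_of_le_of_le tendsto_const_nhds hsum (fun _ => zero_le)
    fun N => ?_
  refine (measure_mono fun ω hω => ?_).trans (measure_iUnion_fintype_le (ℙ N) _)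
  by_contra hcon
  simp only [Set.mem_iUnion, Set.mem_ofPred_eq, not_exists, not_le] at hcon
  exact absurd ((dist_pi_lt_iff hε).2 hcon) (not_lt.2 hω)

theorem TendstoInProb.sum {X : ∀ N, Ω N → Fin d → ℝ} {c : Fin d → ℝ}
    (h : TendstoInProb ℙ X c) : TendstoInProb ℙ (fun N ω => ∑ k, X N ω k) (∑ k, c k) := by
  intro ε hε
  -- Dividing by `d + 1` instead of `d` also covers `d = 0`.
  refine tendsto_of_tendsto_of_tendsto_of_le_of_le tendsto_const_nhds
    (h (ε / (d + 1)) (by positivity)) (fun _ => zero_le) fun N => measure_mono fun ω hω => ?_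
  have hω : ε ≤ dist (∑ k, X N ω k) (∑ k, c k) := hω
  rw [Set.mem_ofPred_eq, div_le_iff₀ (by positivity)]
  have h1 : dist (∑ k, X N ω k) (∑ k, c k) ≤ ∑ _k : Fin d, dist (X N ω) c :=
    (dist_sum_sum_le _ _ _).trans (Finset.sum_le_sum fun k _ => dist_le_pi_dist _ _ k)
  rw [Finset.sum_const, Finset.card_univ, Fintype.card_fin, nsmul_eq_mul] at h1
  have h2 : 0 ≤ dist (X N ω) c := dist_nonneg
  linarith

theorem tendstoInProb_of_eventually_le [∀ N, IsProbabilityMeasure (ℙ N)] {X : ∀ N, Ω N → ℝ} {c : ℝ}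
    (h : ∀ ε : ℝ, 0 < ε → ∃ b : ℕ → ℝ, Tendsto b atTop (𝓝 0) ∧
      ∀ᶠ N in atTop, (ℙ N).real {ω | ε ≤ |X N ω - c|} ≤ b N) : TendstoInProb ℙ X c := by
  intro ε hε
  obtain ⟨b, hb, hle⟩ := h ε hε
  have h1 : Tendsto (fun N => (ℙ N).real {ω | ε ≤ |X N ω - c|}) atTop (𝓝 0) :=
    squeeze_zero' (Eventually.of_forall fun _ => measureReal_nonneg) hle hb
  have h2 := ENNReal.tendsto_ofReal h1
  rw [ENNReal.ofReal_zero] at h2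
  refine h2.congr fun N => ?_
  rw [ofReal_measureReal]
  rfl

end Convergence

/-! ### The transient and stationary limits. -/

section ModelII

variable {d : ℕ} {Q : Matrix (Fin d) (Fin d) ℝ} {π lam mu : Fin d → ℝ} {α : ℝ}

theorem tendsto_superErr (hα : 0 < α) (l m H C : ℝ) :
    Tendsto (fun N : ℕ => superErr l m H C ((N : ℝ) ^ α)⁻¹ (N : ℝ)⁻¹) atTop (𝓝 0) := by
  have h1 : Tendsto (fun N : ℕ => ((N : ℝ) ^ α)⁻¹) atTop (𝓝 0) :=
    ((tendsto_rpow_atTop hα).comp tendsto_natCast_atTop_atTop).inv_tendsto_atTop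
  have h2 : Tendsto (fun N : ℕ => (N : ℝ)⁻¹) atTop (𝓝 0) := tendsto_inv_atTop_nhds_zero_nat
  have h3 := ((((h1.pow 2).const_mul 4).mul_const (l ^ 2)).mul_const H).add
    (((h2.const_mul (2 * l)).add ((h1.mul_const (l ^ 2)).mul_const C)).div_const m)
  simpa [superErr] using h3

theorem tendsto_corrector (hα : 0 < α) (l H : ℝ) :
    Tendsto (fun N : ℕ => ((N : ℝ) ^ α)⁻¹ ^ 2 * l ^ 2 * H) atTop (𝓝 0) := by
  have h1 : Tendsto (fun N : ℕ => ((N : ℝ) ^ α)⁻¹) atTop (𝓝 0) :=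
    ((tendsto_rpow_atTop hα).comp tendsto_natCast_atTop_atTop).inv_tendsto_atTop
  simpa using ((h1.pow 2).mul_const (l ^ 2)).mul_const H

theorem exists_corrector (hQ : IsIrreducibleRateMatrix Q) (hπ : IsStationaryVector Q π)
    (k : Fin d) : ∃ (h : Fin d → ℝ) (H C : ℝ),
      (∀ i, ∑ j, Q i j * h j = (if i = k then 1 else 0) - π k) ∧ (∀ i, h i ^ 2 ≤ H) ∧
      (∀ i, ∑ j, Q i j * h j ^ 2 - 2 * h i * ((if i = k then 1 else 0) - π k) ≤ C) ∧ 0 ≤ C := by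
  obtain ⟨h, hh⟩ := hQ.exists_poisson hπ k
  have : Nonempty (Fin d) := ⟨k⟩
  obtain ⟨a, ha⟩ := Finite.exists_max fun i => h i ^ 2
  obtain ⟨b, hb⟩ := Finite.exists_max fun i =>
    ∑ j, Q i j * h j ^ 2 - 2 * h i * ((if i = k then 1 else 0) - π k)
  exact ⟨h, h a ^ 2, _, hh, ha, fun i => (hb i).trans (le_max_left _ 0), le_max_right _ _⟩

variable {Ω : ℕ → Type*} [∀ N, MeasurableSpace (Ω N)] {ℙ : ∀ N, Measure (Ω N)}
  [∀ N, IsProbabilityMeasure (ℙ N)]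

theorem tendstoInProb_transient_coord (hQ : IsIrreducibleRateMatrix Q)
    (hπ : IsStationaryVector Q π) (hlam : ∀ k, 0 ≤ lam k) (hmu : ∀ k, 0 < mu k) (hα : 0 < α)
    {M : ∀ N, ℝ → Ω N → Fin d → ℕ} {J : ∀ N, ℝ → Ω N → Fin d}
    (hMJ : ∀ N, 1 ≤ N → IsMarkovProcess (ℙ N) (scaledRate Q lam mu α N)
      (fun t ω => (M N t ω, J N t ω)))
    (hM0 : ∀ N, 1 ≤ N → ∀ᵐ ω ∂(ℙ N), M N 0 ω = 0) {t : ℝ} (ht : 0 ≤ t) (k : Fin d) :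
    TendstoInProb ℙ (fun N ω => (M N t ω k : ℝ) / N) (rhoT π lam mu t k) := by
  obtain ⟨h, H, C, hh, hH, hC, hC0⟩ := exists_corrector hQ hπ k
  refine tendstoInProb_of_eventually_le fun ε hε => ?_
  refine ⟨fun N => 4 / ε ^ 2 * (2 * (((N : ℝ) ^ α)⁻¹ ^ 2 * lam k ^ 2 * H)
    + superErr (lam k) (mu k) H C ((N : ℝ) ^ α)⁻¹ (N : ℝ)⁻¹), ?_, ?_⟩
  · simpa using (((tendsto_corrector hα (lam k) H).const_mul 2).add
      (tendsto_superErr hα (lam k) (mu k) H C)).const_mul (4 / ε ^ 2)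
  filter_upwards [eventually_ge_atTop 1,
    (tendsto_corrector hα (lam k) H).eventually_le_const (show 0 < ε ^ 2 / 4 by positivity)]
    with N hN hsmall
  obtain ⟨P, hP, hlaw⟩ := (hMJ N hN).exists_hasSum_law ht
  have hX0 := (hMJ N hN).measurable 0 le_rfl
  have hsum := hasSum_law_mul_semigroupApply hP hX0
    ((hMJ N hN).measurable t ht) ht hlaw {y | ε ≤ |(y.1 k : ℝ) / N - rhoT π lam mu t k|}
  refine (hasSum_le (fun x => ?_) hsum
    ((hasSum_measureReal_eq (ℙ := ℙ N) hX0).mul_right _)).trans_eq (one_mul _)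
  -- From the empty state the prediction equals `rhoT`, so only the corrector and the additive error
  -- survive. Other initial states carry no mass.
  by_cases hx : x.1 = 0
  · refine mul_le_mul_of_nonneg_left ?_ measureReal_nonneg
    refine (semigroupApply_indicator_le hQ hlam hmu hN hP hh hH hC hC0 hε hsmall ht x).trans ?_
    refine mul_le_mul_of_nonneg_left ?_ (by positivity)
    have hD := superErr_nonneg (hlam k) (hmu k) ((sq_nonneg _).trans (hH k)) hC0
      (inv_nonneg.2 (Real.rpow_nonneg (Nat.cast_nonneg N) α)) (inv_nonneg.2 (Nat.cast_nonneg N))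
    set D := superErr (lam k) (mu k) H C ((N : ℝ) ^ α)⁻¹ (N : ℝ)⁻¹
    set th := ((N : ℝ) ^ α)⁻¹
    have he : 0 ≤ Real.exp (-(mu k * t)) := (Real.exp_pos _).le
    have he' : Real.exp (-(mu k * t)) ≤ 1 :=
      Real.exp_le_one_iff.2 (neg_nonpos.2 (mul_nonneg (hmu k).le ht))
    rw [show rhoT π lam mu t k = rho π lam mu k * (1 - Real.exp (-(mu k * t))) from rfl, hx]
    set e := Real.exp (-(mu k * t))
    have h1 : e ^ 2 * (th ^ 2 * lam k ^ 2 * h x.2 ^ 2) ≤ 1 * (th ^ 2 * lam k ^ 2 * H) :=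
      mul_le_mul (pow_le_one₀ he he') (mul_le_mul_of_nonneg_left (hH _) (by positivity))
        (by positivity) zero_le_one
    have h2 : (2 - e) * (e ^ 2 * (th ^ 2 * lam k ^ 2 * h x.2 ^ 2)) ≤
        2 * (1 * (th ^ 2 * lam k ^ 2 * H)) :=
      mul_le_mul (by linarith) h1 (by positivity) zero_le_two
    have h3 : 0 ≤ e * D := mul_nonneg he hD
    simp only [superSol, Pi.zero_apply, Nat.cast_zero, zero_div]
    linear_combination h2 + h3
  · have : (ℙ N).real {ω | (M N 0 ω, J N 0 ω) = x} = 0 := by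
      rw [measureReal_eq_zero_iff]
      refine measure_mono_null (t := {ω | ¬M N 0 ω = 0}) (fun ω hω h0 => hx ?_)
        (ae_iff.1 (hM0 N hN))
      have hω : (M N 0 ω, J N 0 ω) = x := hω
      rw [← hω]
      exact h0
    rw [this, zero_mul, zero_mul]

/-- By invariance the left side is an average of the transient probabilities for every `t`. As `t →
∞`, so `e → 0`, the supersolution centred at `rho` tends to its additive error from each initial
state. -/
theorem measureReal_stationary_le {Ω : Type*} [MeasurableSpace Ω] {ℙ : Measure Ω}
    [IsProbabilityMeasure ℙ] (hQ : IsIrreducibleRateMatrix Q)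
    (hlam : ∀ k, 0 ≤ lam k) (hmu : ∀ k, 0 < mu k) {N : ℕ} (hN : 1 ≤ N)
    {Z : Ω → (Fin d → ℕ) × Fin d} (hZ : HasStationaryLaw ℙ (scaledRate Q lam mu α N) Z)
    {k : Fin d} {h : Fin d → ℝ} {H C : ℝ}
    (hh : ∀ i, ∑ j, Q i j * h j = (if i = k then 1 else 0) - π k)
    (hH : ∀ i, h i ^ 2 ≤ H)
    (hC : ∀ i, ∑ j, Q i j * h j ^ 2 - 2 * h i * ((if i = k then 1 else 0) - π k) ≤ C)
    (hC0 : 0 ≤ C) {ε : ℝ} (hε : 0 < ε)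
    (hsmall : ((N : ℝ) ^ α)⁻¹ ^ 2 * lam k ^ 2 * H ≤ ε ^ 2 / 4) :
    ℙ.real {ω | ε ≤ |((Z ω).1 k : ℝ) / N - rho π lam mu k|} ≤
      4 / ε ^ 2 * superErr (lam k) (mu k) H C ((N : ℝ) ^ α)⁻¹ (N : ℝ)⁻¹ := by
  obtain ⟨P, hP, hlaw⟩ := hZ.stationary
  set A : Set ((Fin d → ℕ) × Fin d) := {y | ε ≤ |(y.1 k : ℝ) / N - rho π lam mu k|}
  have hsum := fun t ht =>
    hasSum_law_mul_semigroupApply hP hZ.measurable hZ.measurable ht (hlaw t ht) A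
  set D := superErr (lam k) (mu k) H C ((N : ℝ) ^ α)⁻¹ (N : ℝ)⁻¹
  set W : ℝ → (Fin d → ℕ) × Fin d → ℝ := fun t x =>
    superSol (lam k) (rho π lam mu k) (rho π lam mu k) ((N : ℝ) ^ α)⁻¹ (N : ℝ)⁻¹ D
      (Real.exp (-(mu k * t))) ((x.1 k : ℝ) / N) (h x.2)
  have hWlim : ∀ x, Tendsto (fun t => W t x) atTop (𝓝 D) := fun x => by
    have h1 : Tendsto (fun t => Real.exp (-(mu k * t))) atTop (𝓝 0) :=
      Real.tendsto_exp_neg_atTop_nhds_zero.comp (tendsto_id.const_mul_atTop (hmu k))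
    have h2 := (hasDerivAt_superSol (lam k) (rho π lam mu k) (rho π lam mu k) ((N : ℝ) ^ α)⁻¹
      (N : ℝ)⁻¹ D 0 ((x.1 k : ℝ) / N) (h x.2)).continuousAt.tendsto.comp h1
    have h3 : superSol (lam k) (rho π lam mu k) (rho π lam mu k) ((N : ℝ) ^ α)⁻¹
      (N : ℝ)⁻¹ D 0 ((x.1 k : ℝ) / N) (h x.2) = D := by
      unfold superSol; ring
    rwa [h3] at h2
  -- The supersolution is unbounded in the initial state; since probabilities are at most one, it
  -- may be clipped to `[0, 1]`, and the stationary law itself dominates.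
  have hdom := tendsto_tsum_of_dominated_convergence (𝓕 := atTop)
    (f := fun t x => ℙ.real {ω | Z ω = x} * max 0 (min 1 (4 / ε ^ 2 * W t x)))
    (hasSum_measureReal_eq (ℙ := ℙ) hZ.measurable).summable
    (fun x => ((tendsto_const_nhds (x := (0 : ℝ))).max ((tendsto_const_nhds (x := (1 : ℝ))).min
      ((hWlim x).const_mul (4 / ε ^ 2)))).const_mul _)
    (Eventually.of_forall fun t x => by
      rw [norm_mul, Real.norm_of_nonneg measureReal_nonneg,
        Real.norm_of_nonneg (le_max_left _ _)]
      exact mul_le_of_le_one_right measureReal_nonneg (max_le zero_le_one (min_le_left _ _)))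
  rw [tsum_mul_right, (hasSum_measureReal_eq (ℙ := ℙ) hZ.measurable).tsum_eq, one_mul] at hdom
  have hD : 0 ≤ D := superErr_nonneg (hlam k) (hmu k) ((sq_nonneg _).trans (hH k)) hC0
    (inv_nonneg.2 (Real.rpow_nonneg (Nat.cast_nonneg N) α)) (inv_nonneg.2 (Nat.cast_nonneg N))
  refine (ge_of_tendsto hdom ?_).trans (max_le (by positivity) (min_le_right _ _))
  filter_upwards [eventually_ge_atTop 0] with t ht
  change ℙ.real {ω | Z ω ∈ A} ≤ _
  rw [← (hsum t ht).tsum_eq]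
  refine (hsum t ht).summable.tsum_le_tsum (fun x => ?_) ?_
  · refine mul_le_mul_of_nonneg_left (le_max_of_le_right (le_min ?_ ?_)) measureReal_nonneg
    · exact hP.semigroupApply_le_one (fun y => Set.indicator_nonneg (fun _ _ => zero_le_one) y)
        (fun y => Set.indicator_le_self' (fun _ _ => zero_le_one) y) ht x
    · exact semigroupApply_indicator_le hQ hlam hmu hN hP hh hH hC hC0 hε hsmall ht x
  · refine (hasSum_measureReal_eq (ℙ := ℙ) hZ.measurable).summable.of_nonneg_of_le
      (fun x => mul_nonneg measureReal_nonneg (le_max_left _ _)) fun x =>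
      mul_le_of_le_one_right measureReal_nonneg (max_le zero_le_one (min_le_left _ _))

theorem tendstoInProb_stationary_coord (hQ : IsIrreducibleRateMatrix Q)
    (hπ : IsStationaryVector Q π) (hlam : ∀ k, 0 ≤ lam k) (hmu : ∀ k, 0 < mu k) (hα : 0 < α)
    {M : ∀ N, Ω N → Fin d → ℕ} {J : ∀ N, Ω N → Fin d}
    (hMJ : ∀ N, 1 ≤ N → HasStationaryLaw (ℙ N) (scaledRate Q lam mu α N)
      (fun ω => (M N ω, J N ω))) (k : Fin d) :
    TendstoInProb ℙ (fun N ω => (M N ω k : ℝ) / N) (rho π lam mu k) := by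
  obtain ⟨h, H, C, hh, hH, hC, hC0⟩ := exists_corrector hQ hπ k
  refine tendstoInProb_of_eventually_le fun ε hε => ?_
  refine ⟨fun N => 4 / ε ^ 2 * superErr (lam k) (mu k) H C ((N : ℝ) ^ α)⁻¹ (N : ℝ)⁻¹, ?_, ?_⟩
  · simpa using (tendsto_superErr hα (lam k) (mu k) H C).const_mul (4 / ε ^ 2)
  filter_upwards [eventually_ge_atTop 1,
    (tendsto_corrector hα (lam k) H).eventually_le_const (show 0 < ε ^ 2 / 4 by positivity)]
    with N hN hsmall
  exact measureReal_stationary_le hQ hlam hmu hN (hMJ N hN) hh hH hC hC0 hε hsmall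

end ModelII
end MMInfServer

theorem mainTheorem6 {d : ℕ} (Q : Matrix (Fin d) (Fin d) ℝ)
    (hQ : MMInfServer.IsIrreducibleRateMatrix Q)
    (π : Fin d → ℝ) (hπ : MMInfServer.IsStationaryVector Q π)
    (lam mu : Fin d → ℝ) (hlam : ∀ k, 0 ≤ lam k) (hmu : ∀ k, 0 < mu k)
    (α : ℝ) (hα : 0 < α)
    {Ω : ℕ → Type*} [∀ N, MeasurableSpace (Ω N)]
    (ℙ : ∀ N, Measure (Ω N)) [∀ N, IsProbabilityMeasure (ℙ N)] :
    -- the transient case: the system starts empty, the law of the background state is arbitrary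
    (∀ (M : ∀ N, ℝ → Ω N → Fin d → ℕ) (J : ∀ N, ℝ → Ω N → Fin d),
      (∀ N, 1 ≤ N → MMInfServer.IsMarkovProcess (ℙ N) (MMInfServer.scaledRate Q lam mu α N)
        (fun t ω => (M N t ω, J N t ω))) →
      (∀ N, 1 ≤ N → ∀ᵐ ω ∂(ℙ N), M N 0 ω = 0) →
      ∀ t : ℝ, 0 ≤ t →
        MMInfServer.TendstoInProb ℙ (fun N ω (k : Fin d) => (M N t ω k : ℝ) / (N : ℝ))
          (MMInfServer.rhoT π lam mu t) ∧
        MMInfServer.TendstoInProb ℙ (fun N ω => (∑ k, (M N t ω k : ℝ)) / (N : ℝ))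
          (∑ k, MMInfServer.rhoT π lam mu t k)) ∧
    -- the stationary case
    (∀ (M : ∀ N, Ω N → Fin d → ℕ) (J : ∀ N, Ω N → Fin d),
      (∀ N, 1 ≤ N → MMInfServer.HasStationaryLaw (ℙ N) (MMInfServer.scaledRate Q lam mu α N)
        (fun ω => (M N ω, J N ω))) →
      MMInfServer.TendstoInProb ℙ (fun N ω (k : Fin d) => (M N ω k : ℝ) / (N : ℝ))
        (MMInfServer.rho π lam mu) ∧
      MMInfServer.TendstoInProb ℙ (fun N ω => (∑ k, (M N ω k : ℝ)) / (N : ℝ))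
        (∑ k, MMInfServer.rho π lam mu k)) := by
  refine ⟨fun M J hMJ hM0 t ht => ?_, fun M J hMJ => ?_⟩
  · have h := MMInfServer.TendstoInProb.of_coord fun k =>
      MMInfServer.tendstoInProb_transient_coord hQ hπ hlam hmu hα hMJ hM0 ht k
    exact ⟨h, by simpa only [Finset.sum_div] using h.sum⟩
  · have h := MMInfServer.TendstoInProb.of_coord fun k =>
      MMInfServer.tendstoInProb_stationary_coord hQ hπ hlam hmu hα hMJ k
    exact ⟨h, by simpa only [Finset.sum_div] using h.sum⟩
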